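/- Let $\ell\ge 1$ and $L=2^\ell$. A replicated sharing of $s\in\mathbb Z_m$ is a triple $(s_1,s_2,s_3)\in\mathbb Z_m^3$ with $s_1+s_2+s_3=s$, of which party $P_j$ holds $(s_j,s_{j+1})$ (indices cyclic); "fresh shares of $s$" means a uniformly random such triple. For $a\in\mathbb Z_L$, represented in $\{0,\dots,L-1\}$, let $\mathsf{MSB}(a)=1$ if $a\ge L/2$ and $0$ otherwise, $\mathsf{DReLU}(a)=1-\mathsf{MSB}(a)$, and $\mathsf{ReLU}(a)=a$ if $a<L/2$ and $0$ otherwise. Let $\mathsf{wrap}_3(a_1,a_2,a_3,L)=\lfloor (a_1+a_2+a_3)/L\rfloor \bmod 2$, the sum being taken over the integers. Ideal functionalities (with abort): each party sends its input; if a party sends abort, or the pairs held by the parties are not consistent, everybody receives abort. Otherwise the corrupted party receives its output first, and then the adversary decides whether the honest parties receive theirs or all of them abort. $\mathcal F_{\mathsf{Mult}}$ returns fresh shares modulo $L$ of the product of two values shared modulo $L$; $\mathcal F_{\mathsf{WA}}$, given a sharing $(a_1,a_2,a_3)$ modulo $L$, returns fresh shares modulo $2$ of $\mathsf{wrap}_3(a_1,a_2,a_3,L)$;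 $\mathcal F_{\mathsf{Prep}}$ returns fresh independent shares modulo $2$ and modulo $L$ of a uniformly random bit $c$; $\mathcal F_{\mathsf{ReLU}}$, given a sharing $(a_1,a_2,a_3)$ modulo $L$, returns fresh shares of $\mathsf{ReLU}(a_1+a_2+a_3 \bmod L)$. The protocol $\Pi_{\mathsf{ReLU}}$ on shares of $a$ modulo $L$: (0) obtain from $\mathcal F_{\mathsf{Prep}}$ shares of a random bit $c$ modulo $2$ and modulo $L$; (1) call $\mathcal F_{\mathsf{WA}}$ on $(2a_1,2a_2,2a_3)$; (2) compute locally shares modulo $2$ of $b=\mathsf{MSB}(a_1)\oplus\mathsf{MSB}(a_2)\oplus\mathsf{MSB}(a_3)\oplus\mathsf{wrap}_3(2a_1,2a_2,2a_3,L)\oplus 1=\mathsf{DReLU}(a)$; (3) select shares with $x=0$, $y=a$ and selection bit $b$: open $e=b\oplus c$ (each $P_j$ sends $e_j$ to $P_{j+1}$ and $e_{j+1}$ to $P_{j-1}$, and aborts if the two values it receives do not agree), put $d=1-c$ if $e=1$ and $d=c$ if $e=0$, obtain shares of $(y-x)d$ from $\mathcal F_{\mathsf{Mult}}$, and output shares of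 $(y-x)d+x$. A party that has aborted sends abort to every later functionality and no messages. Theorem. $\Pi_{\mathsf{ReLU}}$ perfectly securely realizes $\mathcal F_{\mathsf{ReLU}}$ with abort in the presence of one malicious party in the $(\mathcal F_{\mathsf{Mult}},\mathcal F_{\mathsf{WA}},\mathcal F_{\mathsf{Prep}})$-hybrid model. That is, whichever party is corrupted, there is a straight-line black-box simulator (given the input of the corrupted party, interacting with $\mathcal F_{\mathsf{ReLU}}$ and, without rewinding, with the adversary) such that for every (rushing, randomized, computationally unbounded) adversary and every environment that chooses a consistent sharing as input of the parties together with an auxiliary input for the adversary, the joint distribution of the inputs, the outputs of the honest parties, the communication transcript of the adversary and the final state of the adversary is exactly the same in the execution of $\Pi_{\mathsf{ReLU}}$ and in the ideal execution. -/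

import Mathlib

/-! ## Interactive processes, adversaries and straight-line black-box simulators -/

/-- The messages an adversary may receive, and the type of its answer to each of them. -/
structure Interface where
  Query : Type
  Reply : Query → Type

/-- A finite randomized process that interacts with an adversary through the interface `I`
and finally returns an element of `H`. -/
inductive Proc (I : Interface) (H : Type) : Type 1
  | ret (h : H) : Proc I H
  | rand {α : Type} (p : PMF α) (k : α → Proc I H) : Proc I H
  | ask (q : I.Query) (k : I.Reply q → Proc I H) : Proc I H

/-- Sequential composition of processes. -/
def Proc.bind {I : Interface} {H K : Type} : Proc I H → (H → Proc I K) → Proc I K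
  | .ret h, f => f h
  | .rand p k, f => .rand p fun a => (k a).bind f
  | .ask q k, f => .ask q fun r => (k r).bind f

/-- An arbitrary (computationally unbounded, randomized, stateful) adversary. It is started on the
input of the corrupted party and on an auxiliary input chosen by the environment. -/
structure Adversary (I : Interface) (In Z : Type) where
  State : Type
  init : In → Z → PMF State
  step : State → (q : I.Query) → PMF (I.Reply q × State)

/-- The messages exchanged with the adversary, in order. -/
abbrev Interface.Transcript (I : Interface) : Type := List ((q : I.Query) × I.Reply q)

/-- Run a process against an adversary: the joint distribution of the result of the process,
the communication transcript and the final state of the adversary. -/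
noncomputable def Proc.run {I : Interface} {H In Z : Type} (A : Adversary I In Z) :
    Proc I H → A.State → PMF (H × I.Transcript × A.State)
  | .ret h, s => PMF.pure (h, [], s)
  | .rand p k, s => p.bind fun a => (k a).run A s
  | .ask q k, s => (A.step s q).bind fun rs =>
      ((k rs.1).run A rs.2).map fun o => (o.1, ⟨q, rs.1⟩ :: o.2.1, o.2.2)

/-- A straight-line black-box simulator. It knows the input of the corrupted party, plays the
corrupted party towards a process with interface `J` (the ideal world), and may only exchange
messages with an adversary for the interface `I`: it neither inspects nor rewinds the adversary. -/
structure Simulator (J I : Interface) (In : Type) where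
  State : Type
  init : In → State
  handle : State → (q : J.Query) → Proc I (J.Reply q × State)
  finish : State → Proc I Unit

/-- The process obtained by putting the simulator between an ideal world and the adversary. -/
def Simulator.attach {J I : Interface} {In H : Type} (S : Simulator J I In) :
    Proc J H → S.State → Proc I H
  | .ret h, t => (S.finish t).bind fun _ => .ret h
  | .rand p k, t => .rand p fun a => S.attach (k a) t
  | .ask q k, t => (S.handle t q).bind fun rt => S.attach (k rt.1) rt.2

/-! ## Three-party protocols in a hybrid model, one malicious party -/

/-- The three parties, in cyclic order: `j + 1` is the next and `j - 1` the previous party. -/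
abbrev Party : Type := Fin 3

/-- The computation of a trusted party: from the three inputs to the distribution of the three
outputs; `none` means that the inputs are rejected. -/
abbrev Functionality (In Out : Type) : Type := (Party → In) → Option (PMF (Party → Out))

/-- A hybrid model: a family of ideal functionalities, and point-to-point channels carrying
messages of type `Msg`. -/
structure HybridModel where
  Idx : Type
  In : Idx → Type
  Out : Idx → Type
  fn : (k : Idx) → Functionality (In k) (Out k)
  Msg : Type

/-- What a corrupted party is asked in a hybrid model: its input to functionality `k`; the result
it obtains from functionality `k` (`none` for abort); the messages that the parties have just
sent to it (an absent message is `none`). -/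
inductive HybridModel.Query (M : HybridModel) : Type
  | submit (k : M.Idx)
  | result (k : M.Idx) (o : Option (M.Out k))
  | incoming (m : Party → Option M.Msg)

/-- The answers: an input to the functionality or `none` for abort; whether the functionality may
deliver its outputs to the honest parties (`true`) or has to abort (`false`; the answer is without
effect if the functionality has aborted already); the messages sent to each of the parties. -/
def HybridModel.Reply (M : HybridModel) : M.Query → Type
  | .submit k => Option (M.In k)
  | .result _ _ => Bool
  | .incoming _ => Party → Option M.Msg

/-- The interface of an adversary in a hybrid model. -/
def HybridModel.interface (M : HybridModel) : Interface := ⟨M.Query, M.Reply⟩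

/-- A synchronous three-party protocol. The index is the type of the local states of the parties;
everything a party does depends only on its own name and local state. -/
inductive Protocol (M : HybridModel) (Out : Type) : Type → Type 1
  /-- Each party outputs a value and stops. -/
  | output {S : Type} (f : Party → S → Out) : Protocol M Out S
  /-- Local randomized computation. -/
  | compute {S S' : Type} (f : Party → S → PMF S') (rest : Protocol M Out S') : Protocol M Out S
  /-- Call of a functionality. -/
  | call {S S' : Type} (k : M.Idx) (input : Party → S → M.In k)
      (next : Party → S → M.Out k → S') (rest : Protocol M Out S') : Protocol M Out S
  /-- One round of messages: `send j s r` is what party `j` sends to party `r`; a party aborts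
  if `recv` returns `none`. -/
  | exchange {S S' : Type} (send : Party → S → Party → M.Msg)
      (recv : Party → S → (Party → Option M.Msg) → Option S') (rest : Protocol M Out S') :
      Protocol M Out S

/-- Call of functionality `k`, with abort, when party `i` is corrupted; `inp j` is the input of the
honest party `j`, or `none` if it has aborted. If a party sends abort or the inputs are rejected,
everybody receives abort. Otherwise the adversary receives its output first and then decides
whether the honest parties receive theirs or abort. -/
noncomputable def HybridModel.invoke (M : HybridModel) (i : Party) (k : M.Idx)
    (inp : Party → Option (M.In k)) {H : Type}
    (cont : (Party → Option (M.Out k)) → Proc M.interface H) : Proc M.interface H :=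
  .ask (HybridModel.Query.submit k) fun (x : Option (M.In k)) =>
    let full : Party → Option (M.In k) := Function.update inp i x
    let dist : Option (PMF (Party → M.Out k)) :=
      match full 0, full 1, full 2 with
      | some x₀, some x₁, some x₂ => M.fn k ![x₀, x₁, x₂]
      | _, _, _ => none
    match dist with
    | none => .ask (HybridModel.Query.result k none) fun _ => cont fun _ => none
    | some p => .rand p fun y =>
        .ask (HybridModel.Query.result k (some (y i))) fun (go : Bool) =>
          cont fun j => if go then some (y j) else none

/-- Execution of a protocol with corrupted party `i`, seen as a process that interacts with the
adversary and returns the outputs of the honest parties. The state `none` is that of a party that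
has aborted (or is corrupted); an aborted party sends abort to all functionalities and no messages.
The adversary is rushing: it sees the messages sent to it before it sends its own. -/
noncomputable def Protocol.exec {M : HybridModel} {Out : Type} (i : Party) :
    {S : Type} → Protocol M Out S → (Party → Option S) → Proc M.interface (Party → Option Out)
  | _, .output f, st => .ret fun j => (st j).map (f j)
  | _, .compute f rest, st =>
      let draw : Party → PMF (Option _) := fun j =>
        match st j with
        | none => PMF.pure none
        | some s => (f j s).map some
      .rand (draw 0) fun s₀ => .rand (draw 1) fun s₁ => .rand (draw 2) fun s₂ =>
        rest.exec i ![s₀, s₁, s₂]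
  | _, .call k input next rest, st =>
      M.invoke i k (fun j => (st j).map (input j)) fun o =>
        rest.exec i fun j => if j = i then none else
          (st j).bind fun s => (o j).map fun y => next j s y
  | _, .exchange send recv rest, st =>
      let sent : Party → Party → Option M.Msg := fun j r => (st j).map fun s => send j s r
      .ask (HybridModel.Query.incoming fun j => if j = i then none else sent j i)
        fun (m : Party → Option M.Msg) =>
          rest.exec i fun r => if r = i then none else
            (st r).bind fun s => recv r s fun j => if j = i then m r else sent j r

/-- The local states at the start: honest parties hold their inputs. -/
def startState {In : Type} (i : Party) (x : Party → In) : Party → Option In :=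
  fun j => if j = i then none else some (x j)

/-- The model in which the single functionality `F` is available. -/
def idealModel {In Out : Type} (F : Functionality In Out) : HybridModel where
  Idx := Unit
  In := fun _ => In
  Out := fun _ => Out
  fn := fun _ => F
  Msg := Empty

/-- The ideal protocol: send the input to `F`, output what `F` returns. -/
def idealProtocol {In Out : Type} (F : Functionality In Out) : Protocol (idealModel F) Out In :=
  .call (M := idealModel F) () (fun _ x => x) (fun _ _ y => y) (.output fun _ y => y)

/-- Joint distribution of the inputs, the auxiliary input, the outputs of the honest parties, the
communication transcript and the final state of the adversary, where the environment chooses the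
inputs and the auxiliary input, `i` is corrupted, and `world` is the process that the adversary
interacts with. -/
noncomputable def jointDist {I : Interface} {In Z H : Type} (i : Party)
    (world : (Party → In) → Proc I H) (A : Adversary I In Z) (env : PMF ((Party → In) × Z)) :
    PMF (((Party → In) × Z) × H × I.Transcript × A.State) :=
  env.bind fun xz => (A.init (xz.1 i) xz.2).bind fun s =>
    ((world xz.1).run A s).map fun o => (xz, o)

/-- The protocol `P` perfectly securely realizes the functionality `F` with abort in the presence of
one malicious party, on inputs from `valid`, in the hybrid model `M`: whichever party is corrupted,
there is a straight-line black-box simulator such that for every adversary and every environment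
the hybrid execution and the ideal execution have exactly the same joint distribution. -/
def SecurelyRealizesWithAbort {M : HybridModel} {In Out : Type} (P : Protocol M Out In)
    (F : Functionality In Out) (valid : Set (Party → In)) : Prop :=
  ∀ i : Party, ∃ S : Simulator (idealModel F).interface M.interface In,
    ∀ (Z : Type) (A : Adversary M.interface In Z) (env : PMF ((Party → In) × Z)),
      (∀ xz ∈ env.support, xz.1 ∈ valid) →
        jointDist i (fun x => P.exec i (startState i x)) A env =
          jointDist i
            (fun x => S.attach ((idealProtocol F).exec i (startState i x)) (S.init (x i))) A env

/-! ## Replicated secret sharing -/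

/-- What one party holds of a replicated sharing `(x_j)` modulo `m`: party `j` holds
`(x_j, x_{j+1})`. -/
abbrev Share (m : ℕ) : Type := ZMod m × ZMod m

/-- Distribution of the components of a sharing to the parties. -/
def toShares {m : ℕ} (x : Party → ZMod m) (j : Party) : Share m := (x j, x (j + 1))

/-- The parties agree on the components that they hold in common. -/
def ConsistentShares {m : ℕ} (v : Party → Share m) : Prop := ∀ j : Party, (v j).2 = (v (j + 1)).1

instance {m : ℕ} (v : Party → Share m) : Decidable (ConsistentShares v) :=
  inferInstanceAs (Decidable (∀ j : Party, (v j).2 = (v (j + 1)).1))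

/-- The components of a consistent sharing. -/
def components {m : ℕ} (v : Party → Share m) : Party → ZMod m := fun j => (v j).1

/-- Uniformly random `(x_j)` with `x_0 + x_1 + x_2 = s`, distributed to the parties. -/
noncomputable def freshShares {m : ℕ} [NeZero m] (s : ZMod m) : PMF (Party → Share m) :=
  (PMF.uniformOfFinset (Finset.univ.filter fun x : Party → ZMod m => ∑ j, x j = s)
    ⟨Pi.single 0 s, by simp⟩).map toShares

/-- Local addition of a public constant: it is added to the first component. -/
def Share.addConst {m : ℕ} (j : Party) (k : ZMod m) (s : Share m) : Share m :=
  (s.1 + if j = 0 then k else 0, s.2 + if j + 1 = 0 then k else 0)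

/-! ## Most significant bit, ReLU and wrap in `ℤ / 2 ^ l` -/

/-- The most significant bit of the `l`-bit number `a`. -/
def msb {l : ℕ} (a : ZMod (2 ^ l)) : ZMod 2 := if 2 ^ (l - 1) ≤ a.val then 1 else 0

/-- ReLU for two's complement: the first `2 ^ (l - 1)` residues are the nonnegative numbers, the
others are the negative numbers. -/
def relu {l : ℕ} (a : ZMod (2 ^ l)) : ZMod (2 ^ l) := if a.val < 2 ^ (l - 1) then a else 0

/-- The exact wrap function. -/
def wrap3e {m : ℕ} (a : Party → ZMod m) : ℕ :=
  if ∑ j, (a j).val < m then 0 else if ∑ j, (a j).val < 2 * m then 1 else 2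

/-- The wrap function: the exact wrap function modulo 2. -/
def wrap3 {m : ℕ} (a : Party → ZMod m) : ZMod 2 := (wrap3e a : ZMod 2)

/-! ## The ideal functionalities -/

/-- Fresh shares of the wrap function of the components of the input sharing. -/
noncomputable def FWA (l : ℕ) : Functionality (Share (2 ^ l)) (Share 2) := fun v =>
  if ConsistentShares v then some (freshShares (wrap3 (components v))) else none

/-- Fresh shares of the product of two shared values. -/
noncomputable def FMult (l : ℕ) :
    Functionality (Share (2 ^ l) × Share (2 ^ l)) (Share (2 ^ l)) := fun v =>
  let x : Party → Share (2 ^ l) := fun j => (v j).1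
  let y : Party → Share (2 ^ l) := fun j => (v j).2
  if ConsistentShares x ∧ ConsistentShares y then
    some (freshShares ((∑ j, components x j) * ∑ j, components y j))
  else none

/-- Preprocessing: fresh shares of a uniformly random bit, modulo 2 and modulo `2 ^ l`. -/
noncomputable def FPrep (l : ℕ) : Functionality Unit (Share 2 × Share (2 ^ l)) := fun _ =>
  some ((PMF.uniformOfFintype Bool).bind fun c =>
    (freshShares (if c then 1 else 0 : ZMod 2)).bind fun c₂ =>
      (freshShares (if c then 1 else 0 : ZMod (2 ^ l))).map fun cL => fun j => (c₂ j, cL j))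

/-- Fresh shares of `ReLU (a_0 + a_1 + a_2)`. -/
noncomputable def FReLU (l : ℕ) : Functionality (Share (2 ^ l)) (Share (2 ^ l)) := fun v =>
  if ConsistentShares v then some (freshShares (relu (∑ j, components v j))) else none

/-! ## The protocol -/

/-- The functionalities available to the ReLU protocol. -/
inductive ReLUSub : Type
  | mult
  | wa
  | prep

/-- The `(FMult, FWA, FPrep)`-hybrid model; the messages on the channels are bits. -/
noncomputable def reluModel (l : ℕ) : HybridModel where
  Idx := ReLUSub
  In := fun
    | .mult => Share (2 ^ l) × Share (2 ^ l)
    | .wa => Share (2 ^ l)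
    | .prep => Unit
  Out := fun
    | .mult => Share (2 ^ l)
    | .wa => Share 2
    | .prep => Share 2 × Share (2 ^ l)
  fn := fun
    | .mult => FMult l
    | .wa => FWA l
    | .prep => FPrep l
  Msg := ZMod 2

/-- What a party holds before selecting shares: shares of `x`, `y`, of the selection bit `b`, and
of the random bit `c` in both rings. -/
structure SelectState (l : ℕ) where
  x : Share (2 ^ l)
  y : Share (2 ^ l)
  b : Share 2
  c₂ : Share 2
  cL : Share (2 ^ l)

/-- Reconstruction against a malicious party: party `j` sends `e_j` to the next and `e_{j+1}` to the
previous party. -/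
def openSend (j : Party) (e : Share 2) (r : Party) : ZMod 2 := if r = j + 1 then e.1 else e.2

/-- The missing component is received from both other parties; abort if the two received values do
not agree. -/
def openRecv (j : Party) (e : Share 2) (m : Party → Option (ZMod 2)) : Option (ZMod 2) :=
  match m (j + 1), m (j - 1) with
  | some u, some v => if u = v then some (e.1 + e.2 + u) else none
  | _, _ => none

/-- Select shares: outputs shares of `x` if `b = 0` and of `y` if `b = 1`. Open `e = b + c` modulo 2,
let `d = 1 - c` if `e = 1` and `d = c` otherwise, and output `(y - x) * d + x`. -/
noncomputable def selectShares (l : ℕ) :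
    Protocol (reluModel l) (Share (2 ^ l)) (SelectState l) :=
  .exchange (M := reluModel l) (S' := SelectState l × ZMod 2)
    (fun j s r => openSend j (s.b + s.c₂) r)
    (fun j s m => (openRecv j (s.b + s.c₂) m).map fun e => (s, e)) <|
  .call (M := reluModel l) (S' := SelectState l × Share (2 ^ l)) ReLUSub.mult
    (fun j s => (s.1.y - s.1.x, if s.2 = 1 then Share.addConst j 1 (-s.1.cL) else s.1.cL))
    (fun _ s z => (s.1, z)) <|
  .output fun _ s => s.2 + s.1.x

/-- The ReLU protocol: obtain shares of `c`; run `wrap3` on the doubled shares of `a`; compute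
locally shares of `b = msb a_0 + msb a_1 + msb a_2 + wrap3 (2 a) + 1` modulo 2, which is the
derivative of ReLU at `a`; select `a` if `b = 1` and `0` if `b = 0`. -/
noncomputable def reluProtocol (l : ℕ) :
    Protocol (reluModel l) (Share (2 ^ l)) (Share (2 ^ l)) :=
  .call (M := reluModel l) (S' := Share (2 ^ l) × Share 2 × Share (2 ^ l)) ReLUSub.prep
    (fun _ _ => ()) (fun _ a c => (a, c)) <|
  .call (M := reluModel l) (S' := SelectState l) ReLUSub.wa
    (fun _ s => (2 * s.1.1, 2 * s.1.2))
    (fun j s w =>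
      { x := 0
        y := s.1
        b := Share.addConst j 1 (msb s.1.1 + w.1, msb s.1.2 + w.2)
        c₂ := s.2.1
        cL := s.2.2 }) <|
  selectShares l

/-! Correctness. Split each component as `a_j = m_j * 2^(l-1) + r_j` with `m_j` its top bit. The top
bit of the sum is the parity of `∑ m_j` plus the carry of `∑ r_j`, and that carry is the wrap of the
doubled components (`msb_sum`). So `b` is the derivative of ReLU. Unmasking `e = b + c` with `c`
gives `d = b` whatever `c` is, and the multiplication returns fresh shares of `relu a`
(`mul_sum_selector`).

Deviations. The two honest parties together hold all three components, so a functionality accepts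
exactly one share from the corrupted party (`consistentShares_update`). In the opening, every honest
party gets its missing component from the other honest party as well, so a false or absent message
makes it abort (`openRecv_eq`). One aborted honest party makes the multiplication abort for all.
Hence the adversary can only follow the protocol or cause an abort, and the simulator knows which
before it has to submit an input.

Privacy. Seen from party `i`, fresh shares are a uniform pair, whatever the secret
(`freshShares_eq_map`). The only other honest data shown to it before the multiplication is
component `i + 2` of `e`, which is masked by `c`. As `c` has not influenced the view until then,
this component is a uniform bit (`map_uniformOfFintype_mask`). The multiplication then hands out
exactly what the ideal functionality does.

The equality of distributions is proved on processes: `SameRun` allows independent random choices to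
be exchanged and a choice to be postponed past messages that do not depend on it. In this way the
draw of `c` is moved down to the opening. Both worlds are compared with `simulatePrep` followed by
`idealEnd`. -/

/-! ## Processes up to the distribution of their runs -/

/-- Two processes that no adversary can tell apart. -/
def Proc.SameRun {I : Interface} {H : Type} (P Q : Proc I H) : Prop :=
  ∀ (In Z : Type) (A : Adversary I In Z) (s : A.State), P.run A s = Q.run A s

namespace Proc

variable {I : Interface} {H : Type}

theorem SameRun.refl (P : Proc I H) : SameRun P P := fun _ _ _ _ => rfl

theorem SameRun.of_eq {P Q : Proc I H} (h : P = Q) : SameRun P Q := h ▸ SameRun.refl P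

theorem SameRun.symm {P Q : Proc I H} (h : SameRun P Q) : SameRun Q P :=
  fun In Z A s => (h In Z A s).symm

theorem SameRun.trans {P Q R : Proc I H} (h : SameRun P Q) (h' : SameRun Q R) : SameRun P R :=
  fun In Z A s => (h In Z A s).trans (h' In Z A s)

theorem SameRun.ask {q : I.Query} {k k' : I.Reply q → Proc I H} (h : ∀ r, SameRun (k r) (k' r)) :
    SameRun (.ask q k) (.ask q k') := fun In Z A s => by
  simp only [run, h _ In Z A]

theorem SameRun.rand {α : Type} {p : PMF α} {k k' : α → Proc I H}
    (h : ∀ a, SameRun (k a) (k' a)) : SameRun (.rand p k) (.rand p k') := fun In Z A s => by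
  simp only [run, h _ In Z A]

theorem sameRun_rand_map {α β : Type} (p : PMF α) (f : α → β) (k : β → Proc I H) :
    SameRun (.rand (p.map f) k) (.rand p fun a => k (f a)) := fun In Z A s => by
  simp only [run, PMF.bind_map, Function.comp_def]

theorem sameRun_rand_bind {α β : Type} (p : PMF α) (f : α → PMF β) (k : β → Proc I H) :
    SameRun (.rand (p.bind f) k) (.rand p fun a => .rand (f a) k) := fun In Z A s => by
  simp only [run, PMF.bind_bind]

theorem sameRun_rand_const {α : Type} (p : PMF α) (P : Proc I H) :
    SameRun (.rand p fun _ => P) P := fun In Z A s => by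
  simp only [run, PMF.bind_const]

theorem sameRun_rand_comm {α β : Type} (p : PMF α) (q : PMF β) (k : α → β → Proc I H) :
    SameRun (.rand p fun a => .rand q (k a)) (.rand q fun b => .rand p fun a => k a b) :=
  fun In Z A s => by
    simp only [run]
    exact PMF.bind_comm p q _

/-- A random choice may be postponed until after a message that does not depend on it. -/
theorem sameRun_rand_ask {α : Type} (p : PMF α) (q : I.Query) (k : α → I.Reply q → Proc I H) :
    SameRun (.rand p fun a => .ask q (k a)) (.ask q fun r => .rand p fun a => k a r) :=
  fun In Z A s => by
    simp only [run, PMF.map_bind]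
    exact PMF.bind_comm p _ _

theorem bind_ite {K : Type} (c : Prop) [Decidable c] (P Q : Proc I H) (f : H → Proc I K) :
    (if c then P else Q).bind f = if c then P.bind f else Q.bind f := by
  split <;> rfl

end Proc

theorem Proc.bind_assoc {I : Interface} {H K N : Type} (P : Proc I H) (f : H → Proc I K)
    (g : K → Proc I N) : (P.bind f).bind g = P.bind fun h => (f h).bind g := by
  induction P with
  | ret h => rfl
  | rand p k ih => simp only [Proc.bind, ih]
  | ask q k ih => simp only [Proc.bind, ih]

/-- Consistency of the inputs is known only on the support of the environment; elsewhere the weight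
is zero. -/
theorem jointDist_congr {I : Interface} {In Z H : Type} (i : Party)
    {world world' : (Party → In) → Proc I H} (A : Adversary I In Z) (env : PMF ((Party → In) × Z))
    (h : ∀ xz ∈ env.support, Proc.SameRun (world xz.1) (world' xz.1)) :
    jointDist i world A env = jointDist i world' A env := by
  unfold jointDist
  ext o
  simp only [PMF.bind_apply (p := env)]
  refine tsum_congr fun xz => ?_
  by_cases hxz : xz ∈ env.support
  · simp only [h xz hxz In Z A]
  · rw [(PMF.apply_eq_zero_iff _ _).2 hxz, zero_mul, zero_mul]

/-! ## Execution of protocols -/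

section Execution

variable {M : HybridModel} {Out : Type}

/-- The local states when all honest parties have aborted. -/
def aborted {S : Type} : Party → Option S := fun _ => none

/-- A single aborted honest party suffices, whatever the corrupted party submits. The existential
hypothesis covers the state after an opening in which only one honest party has aborted. -/
theorem exec_call_abort (i : Party) {S S' : Type} (k : M.Idx) (input : Party → S → M.In k)
    (next : Party → S → M.Out k → S') (rest : Protocol M Out S') (st : Party → Option S)
    (h : ∃ j, j ≠ i ∧ st j = none) :
    (Protocol.call k input next rest).exec i st =
      .ask (HybridModel.Query.submit k) fun _ =>
        .ask (HybridModel.Query.result k none) fun _ => rest.exec i aborted := by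
  obtain ⟨j, hj, hst⟩ := h
  simp only [Protocol.exec, HybridModel.invoke]
  congr 1
  funext x
  have hfull : Function.update (fun j => (st j).map (input j)) i x j = none := by
    rw [Function.update_of_ne hj, hst]; rfl
  split
  · congr 1
    funext _
    congr 1
    funext j
    unfold aborted
    split
    · rfl
    · cases st j <;> rfl
  · rename_i hp
    exfalso
    split at hp
    · rename_i h0 h1 h2
      fin_cases j <;> simp_all
    · simp at hp

/-- A call treats all honest parties alike, so it leads from `startState` only to `startState` or to
`aborted`. -/
theorem exec_call_start (i : Party) {S S' : Type} (k : M.Idx) (input : Party → S → M.In k)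
    (next : Party → S → M.Out k → S') (rest : Protocol M Out S') (g : Party → S) :
    (Protocol.call k input next rest).exec i (startState i g) =
      .ask (HybridModel.Query.submit k) fun (x : Option (M.In k)) =>
        match x.bind fun x => M.fn k (Function.update (fun j => input j (g j)) i x) with
        | none => .ask (HybridModel.Query.result k none) fun _ => rest.exec i aborted
        | some p => .rand p fun y =>
            .ask (HybridModel.Query.result k (some (y i))) fun (go : Bool) =>
              if go then rest.exec i (startState i fun j => next j (g j) (y j))
              else rest.exec i aborted := by
  simp only [Protocol.exec, HybridModel.invoke]
  congr 1
  funext x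
  -- All honest inputs are present, so the match on the three inputs depends only on whether the
  -- corrupted party submits abort.
  have key : (match Function.update (fun j => (startState i g j).map (input j)) i x 0,
        Function.update (fun j => (startState i g j).map (input j)) i x 1,
        Function.update (fun j => (startState i g j).map (input j)) i x 2 with
      | some x₀, some x₁, some x₂ => M.fn k ![x₀, x₁, x₂]
      | _, _, _ => none) =
      x.bind fun x => M.fn k (Function.update (fun j => input j (g j)) i x) := by
    cases x with
    | none => fin_cases i <;> simp [startState]
    | some x =>
      have hv : ∀ j, Function.update (fun j => (startState i g j).map (input j)) i (some x) j =
          some (Function.update (fun j => input j (g j)) i x j) := by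
        intro j
        by_cases hj : j = i
        · subst hj; simp
        · simp [hj, startState]
      simp only [hv, Option.bind_some]
      congr 1
      funext j
      fin_cases j <;> rfl
  have habort : (fun j => if j = i then none else
      (startState i g j).bind fun s => (none : Option (M.Out k)).map fun y => next j s y) =
      aborted := by
    funext j
    simp [aborted]
  generalize (x.bind fun x => M.fn k (Function.update (fun j => input j (g j)) i x)) = d
    at key ⊢
  split
  all_goals
    rename_i h
    obtain rfl := key.symm.trans h
  · congr 1
    funext _
    exact congrArg _ habort
  · congr 1
    funext y
    congr 1
    funext go
    cases go with
    | false => exact congrArg _ habort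
    | true =>
      simp only [if_true]
      congr 1
      funext j
      by_cases hj : j = i <;> simp [startState, hj]

open Classical in
/-- Call of a functionality that accepts only the input `v` of the corrupted party. -/
theorem exec_call_start_of_unique (i : Party) {S S' : Type} (k : M.Idx)
    (input : Party → S → M.In k) (next : Party → S → M.Out k → S') (rest : Protocol M Out S')
    (g : Party → S) (v : M.In k) (p : PMF (Party → M.Out k))
    (hfn : ∀ x [Decidable (x = v)], M.fn k (Function.update (fun j => input j (g j)) i x) =
      if x = v then some p else none) :
    (Protocol.call k input next rest).exec i (startState i g) =
      .ask (HybridModel.Query.submit k) fun (x : Option (M.In k)) =>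
        if x = some v then .rand p fun y =>
            .ask (HybridModel.Query.result k (some (y i))) fun (go : Bool) =>
              if go then rest.exec i (startState i fun j => next j (g j) (y j))
              else rest.exec i aborted
        else .ask (HybridModel.Query.result k none) fun _ => rest.exec i aborted := by
  rw [exec_call_start]
  congr 1
  funext (x : Option (M.In k))
  have hx : (x.bind fun x => M.fn k (Function.update (fun j => input j (g j)) i x)) =
      if x = some v then some p else none := by
    cases x <;> simp [hfn]
  by_cases h : x = some v
  · rw [if_pos h] at hx ⊢
    simp only [hx]
  · rw [if_neg h] at hx ⊢
    simp only [hx]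

theorem exec_exchange_aborted (i : Party) {S S' : Type} (send : Party → S → Party → M.Msg)
    (recv : Party → S → (Party → Option M.Msg) → Option S') (rest : Protocol M Out S') :
    (Protocol.exchange send recv rest).exec i aborted =
      .ask (HybridModel.Query.incoming fun _ => none) fun _ => rest.exec i aborted := by
  simp only [Protocol.exec, aborted, Option.map_none, Option.bind_none, ite_self]
  congr 2
  simp only [ite_self]

/-- Unlike a call, a round of messages lets honest parties abort separately, so the new state need
be neither `startState` nor `aborted`. -/
theorem exec_exchange_start (i : Party) {S S' : Type} (send : Party → S → Party → M.Msg)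
    (recv : Party → S → (Party → Option M.Msg) → Option S') (rest : Protocol M Out S')
    (g : Party → S) :
    (Protocol.exchange send recv rest).exec i (startState i g) =
      .ask (HybridModel.Query.incoming fun j => if j = i then none else some (send j (g j) i))
        fun (m : Party → Option M.Msg) => rest.exec i fun r => if r = i then none else
          recv r (g r) fun j => if j = i then m r else some (send j (g j) r) := by
  have hsent (r : Party) (o : Option M.Msg) :
      (fun j => if j = i then o else (startState i g j).map fun s => send j s r) =
        fun j => if j = i then o else some (send j (g j) r) := by
    funext j
    by_cases hj : j = i <;> simp [startState, hj]
  simp only [Protocol.exec, hsent]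
  congr 1
  · exact congrArg HybridModel.Query.incoming (hsent i none)
  funext m
  congr 1
  funext r
  by_cases hr : r = i <;> simp [startState, hr]

theorem exec_output_start (i : Party) {S : Type} (f : Party → S → Out) (g : Party → S) :
    (Protocol.output (M := M) f).exec i (startState i g) =
      .ret (startState i fun j => f j (g j)) := by
  simp only [Protocol.exec]
  congr 1
  funext j
  by_cases hj : j = i <;> simp [startState, hj]

end Execution

/-! ## Replicated sharings -/

section Sharing

variable {m : ℕ}

theorem toShares_components {v : Party → Share m} (h : ConsistentShares v) :
    toShares (components v) = v := by
  funext j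
  exact Prod.ext rfl (h j).symm

theorem consistentShares_toShares (a : Party → ZMod m) : ConsistentShares (toShares a) :=
  fun _ => rfl

/-- The share of one party is determined by those of the two others. -/
theorem consistentShares_update (a : Party → ZMod m) (i : Party) (x : Share m) :
    ConsistentShares (Function.update (toShares a) i x) ↔ x = toShares a i := by
  constructor
  · intro h
    have h0 := h 0
    have h1 := h 1
    have h2 := h 2
    fin_cases i <;> simp_all [Function.update, toShares, Prod.ext_iff]
  · rintro rfl
    rw [Function.update_eq_self]
    exact consistentShares_toShares a

/-- The components of the sharing of `s` whose components `i` and `i + 1` are `p`. -/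
def completeShare (i : Party) (s : ZMod m) (p : Share m) : Party → ZMod m := fun j =>
  if j = i then p.1 else if j = i + 1 then p.2 else s - p.1 - p.2

theorem toShares_completeShare (i : Party) (s : ZMod m) (p : Share m) :
    toShares (completeShare i s p) i = p := by
  simp [toShares, completeShare]

/-- Sums are expanded starting from the corrupted party `i`: it holds components `i` and `i + 1` and
misses `i + 2`. -/
theorem sum_party {R : Type*} [AddCommMonoid R] (i : Party) (f : Party → R) :
    ∑ j, f j = f i + f (i + 1) + f (i + 2) := by
  rw [Fin.sum_univ_three]
  fin_cases i
  · rfl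
  · change _ = f 1 + f 2 + f 0; abel
  · change _ = f 2 + f 0 + f 1; abel

theorem completeShare_add_two (i : Party) (s : ZMod m) (p : Share m) :
    completeShare i s p (i + 2) = s - p.1 - p.2 := by
  fin_cases i <;> rfl

theorem sum_completeShare (i : Party) (s : ZMod m) (p : Share m) :
    ∑ j, completeShare i s p j = s := by
  rw [sum_party i, completeShare_add_two]
  simp [completeShare]

/-- Each point of `t` has exactly one preimage, and `t` has the cardinality of `α`. This serves both
for fresh shares and for masking by a random bit. -/
theorem map_uniformOfFintype {α β : Type*} [Fintype α] [Nonempty α] (f : α → β)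
    (hf : Function.Injective f) (t : Finset β) (ht : t.Nonempty) (h : ∀ b, b ∈ t ↔ ∃ a, f a = b) :
    (PMF.uniformOfFintype α).map f = PMF.uniformOfFinset t ht := by
  classical
  have hcard : t.card = Fintype.card α := by
    have : t = Finset.univ.image f := by ext b; simp [h]
    rw [this, Finset.card_image_of_injective _ hf, Finset.card_univ]
  ext b
  rw [PMF.map_apply, PMF.uniformOfFinset_apply, hcard]
  simp only [PMF.uniformOfFintype_apply]
  by_cases hb : b ∈ t
  · obtain ⟨a, rfl⟩ := (h b).1 hb
    rw [if_pos hb, tsum_eq_single a]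
    · simp
    · intro a' ha'
      rw [if_neg fun e => ha' (hf e.symm)]
  · rw [if_neg hb]
    simp only [ENNReal.tsum_eq_zero]
    intro a
    rw [if_neg fun e => hb ((h b).2 ⟨a, e.symm⟩)]

/-- Fresh shares: the two components of one party are uniformly random, and the third one is
determined by them and the shared value. -/
theorem freshShares_eq_map [NeZero m] (i : Party) (s : ZMod m) :
    freshShares s = (PMF.uniformOfFintype (Share m)).map
      fun p => toShares (completeShare i s p) := by
  have : (fun p => toShares (completeShare i s p)) = toShares ∘ completeShare i s := rfl
  rw [this, ← PMF.map_comp, freshShares]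
  congr 1
  symm
  apply map_uniformOfFintype
  · intro p q h
    -- The pair can be read off again as the share of party `i`.
    rw [← toShares_completeShare i s p, h, toShares_completeShare]
  · intro x
    simp only [Finset.mem_filter, Finset.mem_univ, true_and]
    constructor
    · intro hx
      refine ⟨toShares x i, ?_⟩
      rw [sum_party i] at hx
      funext j
      have hj : j = i ∨ j = i + 1 ∨ j = i + 2 := by
        clear hx this; revert i j; decide
      rcases hj with rfl | rfl | rfl
      · simp [completeShare, toShares]
      · simp [completeShare, toShares]
      · rw [completeShare_add_two, ← hx]
        simp only [toShares]; ring
    · rintro ⟨p, rfl⟩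
      exact sum_completeShare i s p

end Sharing

/-! ## The derivative of ReLU -/

section Arithmetic

variable {l : ℕ}

/-- Three residues have a sum below `3 * m`, so the quotient is 0, 1 or 2. -/
theorem wrap3e_eq_div {m : ℕ} [NeZero m] (a : Party → ZMod m) :
    wrap3e a = (∑ j, (a j).val) / m := by
  have hm : 0 < m := Nat.pos_of_ne_zero (NeZero.ne m)
  have h3 : ∑ j, (a j).val < 3 * m := by
    rw [Fin.sum_univ_three]
    have := ZMod.val_lt (a 0)
    have := ZMod.val_lt (a 1)
    have := ZMod.val_lt (a 2)
    omega
  unfold wrap3e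
  symm
  split_ifs
  · exact Nat.div_eq_of_lt ‹_›
  · rw [Nat.div_eq_iff hm]; omega
  · rw [Nat.div_eq_iff hm]; omega

theorem msb_eq_div (hl : 1 ≤ l) (a : ZMod (2 ^ l)) : msb a = ((a.val / 2 ^ (l - 1) : ℕ) : ZMod 2) := by
  have hlt := ZMod.val_lt a
  have h2 : 2 ^ l = 2 * 2 ^ (l - 1) := by rw [← pow_succ']; congr 1; omega
  have hpos : 0 < 2 ^ (l - 1) := by positivity
  replace hlt := hlt.trans_eq h2
  unfold msb
  split_ifs with h
  · rw [(Nat.div_eq_iff hpos).2 (by omega : 1 * 2 ^ (l - 1) ≤ a.val ∧ _)]; simp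
  · rw [Nat.div_eq_of_lt (by omega)]; simp

/-- Since `2^l = 2 * 2^(l-1)`, doubling modulo `2^l` discards the top bit. -/
theorem val_two_mul (hl : 1 ≤ l) (a : ZMod (2 ^ l)) :
    (2 * a).val = 2 * (a.val % 2 ^ (l - 1)) := by
  have h2 : 2 ^ l = 2 * 2 ^ (l - 1) := by rw [← pow_succ']; congr 1; omega
  conv_lhs => rw [← ZMod.natCast_zmod_val a]
  rw [show (2 : ZMod (2 ^ l)) = ((2 : ℕ) : ZMod (2 ^ l)) by simp, ← Nat.cast_mul,
    ZMod.val_natCast]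
  rw [← Nat.mul_mod_mul_left, ← h2]

/-- The most significant bit of a shared value from those of the components and the wrap function
of the doubled components. -/
theorem msb_sum (hl : 1 ≤ l) (a : Party → ZMod (2 ^ l)) :
    msb (∑ j, a j) = ∑ j, msb (a j) + wrap3 fun j => 2 * a j := by
  have h2 : 2 ^ l = 2 * 2 ^ (l - 1) := by rw [← pow_succ']; congr 1; omega
  have hpos : 0 < 2 ^ (l - 1) := by positivity
  have hsum : ∑ j, a j = ((∑ j, (a j).val : ℕ) : ZMod (2 ^ l)) := by
    simp
  -- The quotient of the sum counts the top bits plus the carry of the low parts.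
  have hdiv : (∑ j, (a j).val) / 2 ^ (l - 1) =
      ∑ j, (a j).val / 2 ^ (l - 1) + (∑ j, (a j).val % 2 ^ (l - 1)) / 2 ^ (l - 1) := by
    conv_lhs => rw [← Finset.sum_congr rfl fun j _ => Nat.div_add_mod (a j).val (2 ^ (l - 1))]
    rw [Finset.sum_add_distrib, ← Finset.mul_sum, Nat.mul_add_div hpos]
  -- Reduction modulo `2^l` keeps only the parity of the quotient by `2^(l-1)`.
  have hmod (n : ℕ) : n % 2 ^ l / 2 ^ (l - 1) = n / 2 ^ (l - 1) % 2 := by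
    rw [h2, mul_comm, Nat.mod_mul_right_div_self]
  simp only [msb_eq_div hl, wrap3, wrap3e_eq_div, val_two_mul hl]
  rw [hsum, ZMod.val_natCast, hmod, ZMod.natCast_mod, hdiv, ← Finset.mul_sum]
  -- Doubling numerator and denominator turns the carry into the wrap of the doubled components.
  rw [← Nat.mul_div_mul_left (∑ j, (a j).val % 2 ^ (l - 1)) _ (by norm_num : 0 < 2), ← h2]
  push_cast
  rfl

theorem relu_eq (a : ZMod (2 ^ l)) : relu a = if msb a = 0 then a else 0 := by
  unfold relu msb
  by_cases h : a.val < 2 ^ (l - 1)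
  · simp [h]
  · simp [h, not_lt.1 h]

end Arithmetic

/-! ## The functionalities on the inputs of honest parties -/

section Functionalities

variable {l : ℕ}

theorem components_toShares {m : ℕ} (a : Party → ZMod m) : components (toShares a) = a := rfl

/-- The consistency check becomes an equality test on the corrupted party's input. The decidability
instance is left arbitrary, as `exec_call_start_of_unique` requires. -/
theorem FWA_update (a : Party → ZMod (2 ^ l)) (i : Party) (x : Share (2 ^ l))
    [Decidable (x = toShares a i)] :
    FWA l (Function.update (toShares a) i x) =
      if x = toShares a i then some (freshShares (wrap3 a)) else none := by
  unfold FWA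
  by_cases h : x = toShares a i
  · rw [if_pos ((consistentShares_update a i x).2 h), if_pos h, h, Function.update_eq_self,
      components_toShares]
  · rw [if_neg (mt (consistentShares_update a i x).1 h), if_neg h]

theorem FReLU_update (a : Party → ZMod (2 ^ l)) (i : Party) (x : Share (2 ^ l))
    [Decidable (x = toShares a i)] :
    FReLU l (Function.update (toShares a) i x) =
      if x = toShares a i then some (freshShares (relu (∑ j, a j))) else none := by
  unfold FReLU
  by_cases h : x = toShares a i
  · rw [if_pos ((consistentShares_update a i x).2 h), if_pos h, h, Function.update_eq_self,
      components_toShares]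
  · rw [if_neg (mt (consistentShares_update a i x).1 h), if_neg h]

theorem FMult_update (a d : Party → ZMod (2 ^ l)) (i : Party)
    (x : Share (2 ^ l) × Share (2 ^ l)) [Decidable (x = (toShares a i, toShares d i))] :
    FMult l (Function.update (fun j => (toShares a j, toShares d j)) i x) =
      if x = (toShares a i, toShares d i) then
        some (freshShares ((∑ j, a j) * ∑ j, d j)) else none := by
  have h1 : (fun j => (Function.update (fun j => (toShares a j, toShares d j)) i x j).1) =
      Function.update (toShares a) i x.1 := by
    funext j
    by_cases hj : j = i
    · subst hj; simp
    · simp [hj]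
  have h2 : (fun j => (Function.update (fun j => (toShares a j, toShares d j)) i x j).2) =
      Function.update (toShares d) i x.2 := by
    funext j
    by_cases hj : j = i
    · subst hj; simp
    · simp [hj]
  simp only [FMult, h1, h2]
  by_cases h : x = (toShares a i, toShares d i)
  · rw [if_pos h, if_pos]
    · simp only [h, Function.update_eq_self, components_toShares]
    · simp only [consistentShares_update, h, and_self]
  · rw [if_neg h, if_neg]
    rw [consistentShares_update, consistentShares_update]
    exact fun h' => h (Prod.ext h'.1 h'.2)

end Functionalities

/-! ## The simulator -/

section Simulation

variable {l : ℕ}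

/-- The call of the multiplication when honest parties have aborted. -/
noncomputable def simulateMultAborted : Proc (reluModel l).interface (Option (Share (2 ^ l))) :=
  .ask (HybridModel.Query.submit (M := reluModel l) ReLUSub.mult) fun _ => .ret none

/-- The opening of `e` and the rest when the honest parties have aborted. -/
noncomputable def simulateOpenAborted : Proc (reluModel l).interface (Option (Share (2 ^ l))) :=
  .ask (HybridModel.Query.incoming (M := reluModel l) fun _ => none) fun _ => simulateMultAborted

/-- The call of the wrap functionality and the rest when the honest parties have aborted. -/
noncomputable def simulateWrapAborted : Proc (reluModel l).interface (Option (Share (2 ^ l))) :=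
  .ask (HybridModel.Query.submit (M := reluModel l) ReLUSub.wa) fun _ =>
    .ask (HybridModel.Query.result (M := reluModel l) ReLUSub.wa none) fun _ => simulateOpenAborted

open Classical in
/-- The call of the multiplication when the corrupted party holds the shares `a` and `d`. The
result is what the simulator submits to the ideal functionality. -/
noncomputable def simulateMult (a d : Share (2 ^ l)) :
    Proc (reluModel l).interface (Option (Share (2 ^ l))) :=
  .ask (HybridModel.Query.submit (M := reluModel l) ReLUSub.mult)
    fun (x : Option (Share (2 ^ l) × Share (2 ^ l))) =>
      .ret (if x = some (a, d) then some a else none)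

/-- The share of `d`, given the public value `e` and the share of `c`. -/
noncomputable def selectorShare (i : Party) (e : ZMod 2) (c : Share (2 ^ l)) : Share (2 ^ l) :=
  if e = 1 then Share.addConst i 1 (-c) else c

/-- The opening of `e` and the rest, when the corrupted party `i` holds the share `e` and misses
the component `u`. -/
noncomputable def simulateOpen (i : Party) (a : Share (2 ^ l)) (e : Share 2) (c : Share (2 ^ l))
    (u : ZMod 2) : Proc (reluModel l).interface (Option (Share (2 ^ l))) :=
  .ask (HybridModel.Query.incoming (M := reluModel l) fun j => if j = i then none else some u)
    fun (m : Party → Option (ZMod 2)) =>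
      if m (i + 1) = some e.1 ∧ m (i + 2) = some e.2 then
        simulateMult a (selectorShare i (e.1 + e.2 + u) c)
      else simulateMultAborted

/-- The share of `e`, given the shares of `a`, of the result of the wrap functionality and of `c`
modulo 2. -/
noncomputable def maskedShare (i : Party) (a : Share (2 ^ l)) (w c₂ : Share 2) : Share 2 :=
  Share.addConst i 1 (msb a.1 + w.1, msb a.2 + w.2) + c₂

open Classical in
/-- The call of the wrap functionality and the rest, when the corrupted party `i` holds the
shares `a`, and `c₂`, `cL` from the preprocessing. -/
noncomputable def simulateWrap (i : Party) (a : Share (2 ^ l)) (c₂ : Share 2) (cL : Share (2 ^ l)) :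
    Proc (reluModel l).interface (Option (Share (2 ^ l))) :=
  .ask (HybridModel.Query.submit (M := reluModel l) ReLUSub.wa) fun (x : Option (Share (2 ^ l))) =>
    if x = some (2 * a.1, 2 * a.2) then
      .rand (PMF.uniformOfFintype (Share 2)) fun w =>
        .ask (HybridModel.Query.result (M := reluModel l) ReLUSub.wa (some w)) fun (go : Bool) =>
          if go then
            .rand (PMF.uniformOfFintype (ZMod 2)) fun u =>
              simulateOpen i a (maskedShare i a w c₂) cL u
          else simulateOpenAborted
    else
      .ask (HybridModel.Query.result (M := reluModel l) ReLUSub.wa none) fun _ =>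
        simulateOpenAborted

/-- The execution of the ReLU protocol up to the input of the corrupted party `i` to the
multiplication. -/
noncomputable def simulatePrep (i : Party) (a : Share (2 ^ l)) :
    Proc (reluModel l).interface (Option (Share (2 ^ l))) :=
  .ask (HybridModel.Query.submit (M := reluModel l) ReLUSub.prep) fun (x : Option Unit) =>
    match x with
    | none =>
      .ask (HybridModel.Query.result (M := reluModel l) ReLUSub.prep none) fun _ =>
        simulateWrapAborted
    | some _ =>
      .rand (PMF.uniformOfFintype (Share 2)) fun c₂ =>
        .rand (PMF.uniformOfFintype (Share (2 ^ l))) fun cL =>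
          .ask (HybridModel.Query.result (M := reluModel l) ReLUSub.prep (some (c₂, cL)))
            fun (go : Bool) => if go then simulateWrap i a c₂ cL else simulateWrapAborted

/-- The simulator for the ReLU protocol with corrupted party `i`. It submits the input of the
corrupted party if the adversary has been honest up to the multiplication, and abort otherwise;
the output of the ideal functionality is then passed on as the result of the multiplication. -/
noncomputable def reluSimulator (l : ℕ) (i : Party) :
    Simulator (idealModel (FReLU l)).interface (reluModel l).interface (Share (2 ^ l)) where
  State := Share (2 ^ l)
  init := id
  handle := fun a q =>
    match q with
    | .submit _ => (simulatePrep i a).bind fun x => .ret (x, a)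
    | .result _ o =>
      .ask (HybridModel.Query.result (M := reluModel l) ReLUSub.mult o) fun (go : Bool) =>
        .ret (go, a)
    | .incoming _ => .ret (fun _ => none, a)
  finish := fun _ => .ret ()

open Classical in
/-- The ideal execution after the simulator has submitted `x`. -/
noncomputable def idealEnd (i : Party) (a : Party → ZMod (2 ^ l)) (x : Option (Share (2 ^ l))) :
    Proc (reluModel l).interface (Party → Option (Share (2 ^ l))) :=
  if x = some (toShares a i) then
    .rand (freshShares (relu (∑ j, a j))) fun y =>
      .ask (HybridModel.Query.result (M := reluModel l) ReLUSub.mult (some (y i)))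
        fun (go : Bool) => if go then .ret (startState i y) else .ret aborted
  else
    .ask (HybridModel.Query.result (M := reluModel l) ReLUSub.mult none) fun _ => .ret aborted

/-- The ideal call has two exchanges. The simulator's answer to the first is `simulatePrep`; it
relays the second as the result of the multiplication, which gives `idealEnd`. -/
theorem attach_reluSimulator (i : Party) (a : Party → ZMod (2 ^ l)) :
    (reluSimulator l i).attach
        ((idealProtocol (FReLU l)).exec i (startState i (toShares a)))
        ((reluSimulator l i).init (toShares a i)) =
      (simulatePrep i (toShares a i)).bind (idealEnd i a) := by
  have hexec := exec_call_start_of_unique (M := idealModel (FReLU l)) i () (fun _ x => x)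
    (fun _ _ y => y) (.output fun _ y => y) (toShares a) (toShares a i)
    (freshShares (relu (∑ j, a j))) (@FReLU_update l a i)
  refine (congrArg (fun P => (reluSimulator l i).attach P (toShares a i)) hexec).trans ?_
  change ((simulatePrep i (toShares a i)).bind fun x => .ret (x, toShares a i)).bind _ = _
  refine (Proc.bind_assoc _ _ _).trans ?_
  congr 1
  funext x
  simp only [Proc.bind, idealEnd]
  by_cases h : x = some (toShares a i)
  · refine (congrArg (fun P => (reluSimulator l i).attach P (toShares a i)) (if_pos h)).trans ?_
    rw [if_pos h]
    change Proc.rand _ _ = _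
    congr 1
    funext y
    change Proc.ask _ _ = _
    congr 1
    funext (go : Bool)
    cases go
    · rfl
    · change Simulator.attach _ (Protocol.exec i (.output _) (startState i _)) _ = _
      rw [exec_output_start]
      rfl
  · refine (congrArg (fun P => (reluSimulator l i).attach P (toShares a i)) (if_neg h)).trans ?_
    rw [if_neg h]
    rfl

end Simulation

/-! ## The execution of the protocol -/

section Real

variable {l : ℕ}

/-- The end of the selection of shares, when `e` has been opened. -/
noncomputable def multiplySelector (l : ℕ) :
    Protocol (reluModel l) (Share (2 ^ l)) (SelectState l × ZMod 2) :=
  .call (M := reluModel l) (S' := SelectState l × Share (2 ^ l)) ReLUSub.mult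
    (fun j s => (s.1.y - s.1.x, if s.2 = 1 then Share.addConst j 1 (-s.1.cL) else s.1.cL))
    (fun _ s z => (s.1, z)) <|
  .output fun _ s => s.2 + s.1.x

/-- The ReLU protocol after the preprocessing. -/
noncomputable def wrapAndSelect (l : ℕ) :
    Protocol (reluModel l) (Share (2 ^ l)) (Share (2 ^ l) × Share 2 × Share (2 ^ l)) :=
  .call (M := reluModel l) (S' := SelectState l) ReLUSub.wa
    (fun _ s => (2 * s.1.1, 2 * s.1.2))
    (fun j s w =>
      { x := 0
        y := s.1
        b := Share.addConst j 1 (msb s.1.1 + w.1, msb s.1.2 + w.2)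
        c₂ := s.2.1
        cL := s.2.2 }) <|
  selectShares l

/-- Here the simulator submits abort, and `idealEnd` then no longer depends on `a`. -/
theorem multiplySelector_exec_aborted (i : Party) (a : Party → ZMod (2 ^ l))
    (st : Party → Option (SelectState l × ZMod 2)) (h : ∃ j, j ≠ i ∧ st j = none) :
    (multiplySelector l).exec i st = simulateMultAborted.bind (idealEnd i a) := by
  refine (exec_call_abort (M := reluModel l) _ _ _ _ _ _ h).trans ?_
  simp only [simulateMultAborted, Proc.bind, idealEnd]
  rw [if_neg (by simp)]
  rfl

theorem selectShares_exec_aborted (i : Party) (a : Party → ZMod (2 ^ l)) :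
    (selectShares l).exec i aborted = simulateOpenAborted.bind (idealEnd i a) := by
  refine (exec_exchange_aborted (M := reluModel l) _ _ _ _).trans ?_
  simp only [simulateOpenAborted, Proc.bind]
  congr 1
  funext _
  exact multiplySelector_exec_aborted i a _ ⟨i + 1, by simp, rfl⟩

theorem wrapAndSelect_exec_aborted (i : Party) (a : Party → ZMod (2 ^ l)) :
    (wrapAndSelect l).exec i aborted = simulateWrapAborted.bind (idealEnd i a) := by
  refine (exec_call_abort (M := reluModel l) _ _ _ _ _ _ ⟨i + 1, by simp, rfl⟩).trans ?_
  simp only [simulateWrapAborted, Proc.bind, selectShares_exec_aborted i a]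

/-- The components of the sharing of `d`, given the public value `e` and the components of the
sharing of `c`. -/
def selector (e : ZMod 2) (c : Party → ZMod (2 ^ l)) : Party → ZMod (2 ^ l) := fun j =>
  if e = 1 then -c j + (if j = 0 then 1 else 0) else c j

theorem selectorShare_toShares (j : Party) (e : ZMod 2) (c : Party → ZMod (2 ^ l)) :
    selectorShare j e (toShares c j) = toShares (selector e c) j := by
  unfold selectorShare selector
  split_ifs <;> rfl

theorem sum_selector (e : ZMod 2) (c : Party → ZMod (2 ^ l)) :
    ∑ j, selector e c j = if e = 1 then 1 - ∑ j, c j else ∑ j, c j := by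
  unfold selector
  split_ifs
  · rw [Finset.sum_add_distrib, Finset.sum_neg_distrib, Finset.sum_ite_eq']
    simp
    ring
  · rfl

/-- By `h` the product is `relu` of the secret, so its fresh shares are those of the ideal
functionality. Of `c`, only the corrupted party's own share still matters. -/
theorem multiplySelector_exec_start (i : Party) (a c : Party → ZMod (2 ^ l)) (e : ZMod 2)
    (b c₂ : Party → Share 2) (h : (∑ j, a j) * ∑ j, selector e c j = relu (∑ j, a j)) :
    (multiplySelector l).exec i
        (startState i fun j => (⟨0, toShares a j, b j, c₂ j, toShares c j⟩, e)) =
      (simulateMult (toShares a i) (selectorShare i e (toShares c i))).bind (idealEnd i a) := by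
  refine (exec_call_start_of_unique (M := reluModel l) i ReLUSub.mult _ _ _ _
    (toShares a i, toShares (selector e c) i) (freshShares (relu (∑ j, a j))) ?_).trans ?_
  rotate_left
  · simp only [simulateMult, Proc.bind, selectorShare_toShares]
    congr 1
    funext (x : Option (Share (2 ^ l) × Share (2 ^ l)))
    by_cases hx : x = some (toShares a i, toShares (selector e c) i)
    · refine (if_pos hx).trans ?_
      rw [if_pos hx, idealEnd, if_pos rfl]
      congr 1
      funext y
      congr 1
      funext (go : Bool)
      cases go
      · rfl
      · simp only [if_true, exec_output_start]
        refine congrArg (fun z => Proc.ret (startState i z)) (funext fun j => ?_)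
        -- The shares of `x` are zero.
        exact add_zero (M := Share (2 ^ l)) (y j)
    · refine (if_neg hx).trans ?_
      rw [if_neg hx, idealEnd, if_neg (by simp)]
      rfl
  · intro (x : Share (2 ^ l) × Share (2 ^ l)) inst
    have hinput : (fun j => (toShares a j - 0, if e = 1 then Share.addConst j 1 (-toShares c j)
        else toShares c j)) = fun j => (toShares a j, toShares (selector e c) j) := by
      funext j
      rw [← selectorShare_toShares, sub_zero]
      rfl
    rw [← h]
    exact (congrArg (fun v => FMult l (Function.update v i x)) hinput).trans
      (@FMult_update l a (selector e c) i x inst)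

/-- An honest party either learns the opened value or aborts. -/
theorem openRecv_eq {i r : Party} (e : Party → ZMod 2) (m : Party → Option (ZMod 2))
    (hr : r ≠ i) :
    openRecv r (toShares e r)
        (fun j => if j = i then m r else some (openSend j (toShares e j) r)) =
      if m r = some (e (r + 2)) then some (∑ j, e j) else none := by
  have hsum := sum_party r e
  have hneg : (-1 : Fin 3) = 2 := rfl
  generalize m r = o
  cases o with
  | none => fin_cases i <;> fin_cases r <;> simp [openRecv, hneg] at hr ⊢
  | some o =>
    rw [hsum]
    fin_cases i <;> fin_cases r <;>
      first
      | exact absurd rfl hr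
      | (simp [openRecv, openSend, toShares, hneg]; grind)

/-- Both honest parties send component `i + 2` to party `i`. They expect from it the components `i`
and `i + 1`, which are the two it holds, so the simulator can check its messages. -/
theorem selectShares_exec_start (i : Party) (a c : Party → ZMod (2 ^ l)) (b c₂ : Party → ZMod 2)
    (h : (∑ j, a j) * ∑ j, selector (∑ j, (b j + c₂ j)) c j = relu (∑ j, a j)) :
    (selectShares l).exec i
        (startState i fun j => ⟨0, toShares a j, toShares b j, toShares c₂ j, toShares c j⟩) =
      (simulateOpen i (toShares a i) (toShares b i + toShares c₂ i) (toShares c i)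
        (b (i + 2) + c₂ (i + 2))).bind (idealEnd i a) := by
  have hadd (j : Party) : toShares b j + toShares c₂ j = toShares (fun j => b j + c₂ j) j := rfl
  generalize hst : (fun j => (⟨0, toShares a j, toShares b j, toShares c₂ j, toShares c j⟩ :
    SelectState l)) = g
  have hg (j : Party) : (g j).b + (g j).c₂ = toShares (fun j => b j + c₂ j) j := by
    rw [← hst]; rfl
  rw [hadd]
  change _ = (simulateOpen i (toShares a i) _ (toShares c i)
    ((fun j => b j + c₂ j) (i + 2))).bind (idealEnd i a)
  change (∑ j, a j) * ∑ j, selector (∑ j, (fun j => b j + c₂ j) j) c j = _ at h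
  generalize (fun j => b j + c₂ j) = e at *
  refine (exec_exchange_start (M := reluModel l) _ _ _ _ _).trans ?_
  simp only [simulateOpen, Proc.bind, Proc.bind_ite]
  have hsend : (fun j => if j = i then none else some (openSend j ((g j).b + (g j).c₂) i)) =
      fun j => if j = i then none else some (e (i + 2)) := by
    funext j
    rw [hg]
    fin_cases i <;> fin_cases j <;> simp [openSend, toShares]
  congr 1
  · exact congrArg (HybridModel.Query.incoming (M := reluModel l)) hsend
  funext (m : Party → Option (ZMod 2))
  have hstate : (fun r => if r = i then none else (openRecv r ((g r).b + (g r).c₂)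
        fun j => if j = i then m r else some (openSend j ((g j).b + (g j).c₂) r)).map fun s => (g r, s)) =
      fun r => if r = i then none else
        if m r = some (e (r + 2)) then some (g r, ∑ j, e j) else none := by
    funext r
    simp only [hg]
    split_ifs with hr hm
    · rfl
    · rw [openRecv_eq e m hr, if_pos hm]; rfl
    · rw [openRecv_eq e m hr, if_neg hm]; rfl
  refine (congrArg ((multiplySelector l).exec i) hstate).trans ?_
  have h3 : i + 1 + 2 = i ∧ i + 2 + 2 = i + 1 := by clear * -; revert i; decide
  have hne : i + 1 ≠ i ∧ i + 2 ≠ i := by clear * -; revert i; decide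
  by_cases hm : m (i + 1) = some (e i) ∧ m (i + 2) = some (e (i + 1))
  · refine Eq.trans ?_ (if_pos hm).symm
    have hfull : (fun r => if r = i then none else
        if m r = some (e (r + 2)) then some (g r, ∑ j, e j) else none) =
        startState i fun j => (g j, ∑ j, e j) := by
      funext r
      unfold startState
      split_ifs with hr hmr
      · rfl
      · rfl
      · have hrr : r = i + 1 ∨ r = i + 2 := by
          clear * - hr; revert i r; decide
        rcases hrr with rfl | rfl
        · rw [h3.1] at hmr; exact absurd hm.1 hmr
        · rw [h3.2] at hmr; exact absurd hm.2 hmr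
    rw [hfull, ← hst, multiplySelector_exec_start i a c _ _ _ h]
    rw [sum_party i e]
    rfl
  · refine Eq.trans ?_ (if_neg hm).symm
    apply multiplySelector_exec_aborted
    -- The recipient of the wrong message aborts, and this alone stops the multiplication.
    rcases not_and_or.1 hm with hm | hm
    · exact ⟨i + 1, hne.1, by rw [if_neg hne.1, h3.1, if_neg hm]⟩
    · exact ⟨i + 2, hne.2, by rw [if_neg hne.2, h3.2, if_neg hm]⟩

/-- The sharing of the derivative of ReLU computed by the parties. -/
theorem sum_selection_bit (hl : 1 ≤ l) (a : Party → ZMod (2 ^ l)) (w : Party → ZMod 2)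
    (hw : ∑ j, w j = wrap3 fun j => 2 * a j) :
    ∑ j, (msb (a j) + w j + if j = 0 then 1 else 0) = msb (∑ j, a j) + 1 := by
  rw [Finset.sum_add_distrib, Finset.sum_add_distrib, hw, msb_sum hl, Finset.sum_ite_eq']
  simp

/-- The selection is correct: `d` is the derivative of ReLU. -/
theorem mul_sum_selector (s : ZMod (2 ^ l)) (b c₂ : Party → ZMod 2) (cL : Party → ZMod (2 ^ l))
    (c : Bool) (hb : ∑ j, b j = msb s + 1) (hc : ∑ j, c₂ j = if c then 1 else 0)
    (hcL : ∑ j, cL j = if c then 1 else 0) :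
    s * ∑ j, selector (∑ j, (b j + c₂ j)) cL j = relu s := by
  rw [sum_selector, hcL, Finset.sum_add_distrib, hb, hc, relu_eq]
  have h01 : ∀ u : ZMod 2, u = 0 ∨ u = 1 := by decide
  have h2 : (1 + 1 : ZMod 2) = 0 := rfl
  -- In each of the four cases, unmasking `e` turns `c` back into `b`.
  rcases h01 (msb s) with h | h <;> cases c <;> simp [h, h2]

/-- Masking with a uniformly random bit. -/
theorem map_uniformOfFintype_mask (v : ZMod 2) :
    (PMF.uniformOfFintype Bool).map (fun c => v + if c then 1 else 0) =
      PMF.uniformOfFintype (ZMod 2) := by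
  refine map_uniformOfFintype _ ?_ _ _ ?_
  · revert v; decide
  · revert v; decide

/-- With the corrupted party's preprocessing shares fixed, `c` affects only the third components. It
can thus be drawn after the wrap call, where it either masks the missing component of `e` or is
never used. -/
theorem wrapAndSelect_sameRun (hl : 1 ≤ l) (i : Party) (a : Party → ZMod (2 ^ l)) (c₂ : Share 2)
    (cL : Share (2 ^ l)) :
    Proc.SameRun
      (.rand (PMF.uniformOfFintype Bool) fun c => (wrapAndSelect l).exec i (startState i fun j =>
        (toShares a j, toShares (completeShare i (if c then 1 else 0 : ZMod 2) c₂) j,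
          toShares (completeShare i (if c then 1 else 0 : ZMod (2 ^ l)) cL) j)))
      ((simulateWrap i (toShares a i) c₂ cL).bind (idealEnd i a)) := by
  have hexec (c : Bool) := exec_call_start_of_unique (M := reluModel l) i ReLUSub.wa
    (fun _ (s : Share (2 ^ l) × Share 2 × Share (2 ^ l)) => (2 * s.1.1, 2 * s.1.2))
    (fun j s (w : Share 2) => (
      { x := 0
        y := s.1
        b := Share.addConst j 1 (msb s.1.1 + w.1, msb s.1.2 + w.2)
        c₂ := s.2.1
        cL := s.2.2 } : SelectState l))
    (selectShares l)
    (fun j => (toShares a j, toShares (completeShare i (if c then 1 else 0 : ZMod 2) c₂) j,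
      toShares (completeShare i (if c then 1 else 0 : ZMod (2 ^ l)) cL) j))
    (2 * a i, 2 * a (i + 1)) (freshShares (wrap3 fun j => 2 * a j))
    (@FWA_update l (fun j => 2 * a j) i)
  change ∀ c, (wrapAndSelect l).exec i (startState i _) = _ at hexec
  simp only [hexec]
  refine (Proc.sameRun_rand_ask _ _ _).trans
    (Proc.SameRun.ask fun (x : Option (Share (2 ^ l))) => ?_)
  have hsim := Proc.bind_ite (x = some (2 * a i, 2 * a (i + 1)))
    (.rand (PMF.uniformOfFintype (Share 2)) fun w =>
      .ask (HybridModel.Query.result (M := reluModel l) ReLUSub.wa (some w)) fun (go : Bool) =>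
        if go then
          .rand (PMF.uniformOfFintype (ZMod 2)) fun u =>
            simulateOpen i (toShares a i) (maskedShare i (toShares a i) w c₂) cL u
        else simulateOpenAborted)
    (.ask (HybridModel.Query.result (M := reluModel l) ReLUSub.wa none) fun _ =>
      simulateOpenAborted) (idealEnd i a)
  -- Component `i + 2` of `e` for `c = 0`; the bit `c` is then added to it.
  let missing : Share 2 → ZMod 2 := fun p =>
    msb (a (i + 2)) + ((wrap3 fun j => 2 * a j) - p.1 - p.2) + (if i + 2 = 0 then 1 else 0) +
      (0 - c₂.1 - c₂.2)
  have hopen (c : Bool) : Proc.SameRun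
      (.rand (freshShares (wrap3 fun j => 2 * a j)) fun y =>
        .ask (HybridModel.Query.result (M := reluModel l) ReLUSub.wa (some (y i)))
          fun (go : Bool) =>
            if go then (selectShares l).exec i (startState i fun j =>
              { x := 0
                y := toShares a j
                b := Share.addConst j 1 (msb (a j) + (y j).1, msb (a (j + 1)) + (y j).2)
                c₂ := toShares (completeShare i (if c then 1 else 0 : ZMod 2) c₂) j
                cL := toShares (completeShare i (if c then 1 else 0 : ZMod (2 ^ l)) cL) j })
            else (selectShares l).exec i aborted)
      (.rand (PMF.uniformOfFintype (Share 2)) fun p =>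
        .ask (HybridModel.Query.result (M := reluModel l) ReLUSub.wa (some p))
          fun (go : Bool) =>
            if go then (simulateOpen i (toShares a i) (maskedShare i (toShares a i) p c₂) cL
              (missing p + if c then 1 else 0)).bind (idealEnd i a)
            else simulateOpenAborted.bind (idealEnd i a)) := by
    rw [freshShares_eq_map i]
    refine (Proc.sameRun_rand_map _ _ _).trans (Proc.SameRun.rand fun p => ?_)
    rw [toShares_completeShare]
    refine Proc.SameRun.ask fun (go : Bool) => Proc.SameRun.of_eq ?_
    cases go
    · exact selectShares_exec_aborted i a
    · let w := completeShare i (wrap3 fun j => 2 * a j) p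
      let b : Party → ZMod 2 := fun j => msb (a j) + w j + if j = 0 then 1 else 0
      have hc₂ := toShares_completeShare i (if c then 1 else 0 : ZMod 2) c₂
      have hcL := toShares_completeShare i (if c then 1 else 0 : ZMod (2 ^ l)) cL
      refine (selectShares_exec_start i a
        (completeShare i (if c then 1 else 0 : ZMod (2 ^ l)) cL) b
        (completeShare i (if c then 1 else 0 : ZMod 2) c₂)
        (mul_sum_selector _ _ _ _ c (sum_selection_bit hl a w (sum_completeShare i _ p))
          (sum_completeShare i _ c₂) (sum_completeShare i _ cL))).trans ?_
      have hb : toShares b i = Share.addConst i 1 (msb (a i) + p.1, msb (a (i + 1)) + p.2) := by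
        conv_rhs => rw [← toShares_completeShare i (wrap3 fun j => 2 * a j) p]
        rfl
      have hmissing : b (i + 2) + completeShare i (if c then 1 else 0 : ZMod 2) c₂ (i + 2) =
          missing p + if c then 1 else 0 := by
        simp only [b, w, missing, completeShare_add_two]
        ring
      rw [hc₂, hcL, hb, hmissing]
      rfl
  by_cases hx : x = some (2 * a i, 2 * a (i + 1))
  · refine Proc.SameRun.trans (Proc.SameRun.rand fun c => (Proc.SameRun.of_eq (if_pos hx)).trans
      (hopen c)) ?_
    refine Proc.SameRun.trans ?_ (Proc.SameRun.of_eq (hsim.trans (if_pos hx)).symm)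
    -- The result message shows only `p`, so `c` is drawn after it.
    refine (Proc.sameRun_rand_comm _ _ _).trans (Proc.SameRun.rand fun p => ?_)
    refine (Proc.sameRun_rand_ask _ _ _).trans (Proc.SameRun.ask fun (go : Bool) => ?_)
    cases go
    · exact Proc.sameRun_rand_const _ _
    · refine Proc.SameRun.trans ?_ (Proc.SameRun.of_eq
        (congrArg (fun u => Proc.rand u _) (map_uniformOfFintype_mask (missing p))))
      exact (Proc.sameRun_rand_map _ (fun c : Bool => missing p + if c then 1 else 0) fun u =>
        (simulateOpen i (toShares a i) (maskedShare i (toShares a i) p c₂) cL u).bind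
          (idealEnd i a)).symm
  · refine Proc.SameRun.trans (Proc.SameRun.rand fun c => Proc.SameRun.of_eq (if_neg hx)) ?_
    refine (Proc.sameRun_rand_const _ _).trans ?_
    refine Proc.SameRun.of_eq ((?_ : _ = _).trans (hsim.trans (if_neg hx)).symm)
    rw [selectShares_exec_aborted i a]
    rfl

/-- The corrupted party's preprocessing output is two independent uniform pairs for either value of
`c`, so the draw of `c` moves behind that message. -/
theorem reluProtocol_sameRun (hl : 1 ≤ l) (i : Party) (a : Party → ZMod (2 ^ l)) :
    Proc.SameRun ((reluProtocol l).exec i (startState i (toShares a)))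
      ((simulatePrep i (toShares a i)).bind (idealEnd i a)) := by
  have hreal := exec_call_start (M := reluModel l) i ReLUSub.prep (fun _ _ => ())
    (fun _ (a : Share (2 ^ l)) (c : Share 2 × Share (2 ^ l)) => (a, c)) (wrapAndSelect l)
    (toShares a)
  change (reluProtocol l).exec i (startState i (toShares a)) = _ at hreal
  rw [hreal]
  refine Proc.SameRun.ask fun (x : Option Unit) => ?_
  cases x with
  | none =>
    refine Proc.SameRun.ask fun _ => ?_
    rw [wrapAndSelect_exec_aborted i a]
    exact Proc.SameRun.refl _
  | some x =>
    change Proc.SameRun (.rand ((PMF.uniformOfFintype Bool).bind _) _)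
      (.rand _ fun c₂ => .rand _ fun cL => .ask _ _)
    refine (Proc.sameRun_rand_bind _ _ _).trans ?_
    have hprep (c : Bool) (k : (Party → Share 2 × Share (2 ^ l)) →
        Proc (reluModel l).interface (Party → Option (Share (2 ^ l)))) :
        Proc.SameRun
          (.rand ((freshShares (if c then 1 else 0 : ZMod 2)).bind fun c₂ =>
            (freshShares (if c then 1 else 0 : ZMod (2 ^ l))).map fun cL j => (c₂ j, cL j)) k)
          (.rand (PMF.uniformOfFintype (Share 2)) fun c₂ =>
            .rand (PMF.uniformOfFintype (Share (2 ^ l))) fun cL =>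
              k fun j => (toShares (completeShare i (if c then 1 else 0 : ZMod 2) c₂) j,
                toShares (completeShare i (if c then 1 else 0 : ZMod (2 ^ l)) cL) j)) := by
      rw [freshShares_eq_map i, freshShares_eq_map i]
      refine (Proc.sameRun_rand_bind _ _ _).trans ((Proc.sameRun_rand_map _ _ _).trans
        (Proc.SameRun.rand fun c₂ => ?_))
      exact (Proc.sameRun_rand_map _ _ _).trans (Proc.sameRun_rand_map _ _ _)
    refine (Proc.SameRun.rand fun c => hprep c _).trans ?_
    refine (Proc.sameRun_rand_comm _ _ _).trans (Proc.SameRun.rand fun c₂ => ?_)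
    refine (Proc.sameRun_rand_comm _ _ _).trans (Proc.SameRun.rand fun cL => ?_)
    let k (c go : Bool) : Proc (reluModel l).interface (Party → Option (Share (2 ^ l))) :=
      if go then (wrapAndSelect l).exec i (startState i fun j =>
        (toShares a j, toShares (completeShare i (if c then 1 else 0 : ZMod 2) c₂) j,
          toShares (completeShare i (if c then 1 else 0 : ZMod (2 ^ l)) cL) j))
      else (wrapAndSelect l).exec i aborted
    -- The corrupted party receives `(c₂, cL)`, in which `c` does not occur.
    have hview (c : Bool) := congrArg (fun o => Proc.ask (I := (reluModel l).interface)
        (HybridModel.Query.result (M := reluModel l) ReLUSub.prep (some o)) (k c))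
      (Prod.ext (toShares_completeShare i (if c then 1 else 0 : ZMod 2) c₂)
        (toShares_completeShare i (if c then 1 else 0 : ZMod (2 ^ l)) cL) :
          (toShares _ i, toShares _ i) = (c₂, cL))
    refine (Proc.SameRun.rand fun c => Proc.SameRun.of_eq (hview c)).trans ?_
    refine (Proc.sameRun_rand_ask _ _ _).trans (Proc.SameRun.ask fun (go : Bool) => ?_)
    cases go
    · exact (Proc.sameRun_rand_const _ _).trans
        (Proc.SameRun.of_eq (wrapAndSelect_exec_aborted i a))
    · exact wrapAndSelect_sameRun hl i a c₂ cL

end Real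

theorem theorem3 (l : ℕ) (hl : 1 ≤ l) :
    SecurelyRealizesWithAbort (reluProtocol l) (FReLU l) {a | ConsistentShares a} := by
  intro i
  refine ⟨reluSimulator l i, fun Z A env henv => jointDist_congr i A env fun xz hxz => ?_⟩
  have h := henv xz hxz
  obtain ⟨a, ha⟩ : ∃ a, toShares a = xz.1 := ⟨_, toShares_components h⟩
  rw [← ha, attach_reluSimulator]
  exact reluProtocol_sameRun hl i a
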